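/- (ZFC.) Let $\sigma\mathbb Q$ be the tree of all well-ordered, bounded subsets of $\mathbb Q$ (including $\emptyset$), ordered by end extension: $s\le t$ iff $s\subseteq t$ and every element of $t\setminus s$ is larger than every element of $s$. The height $\operatorname{ht}(t)$ of $t\in\sigma\mathbb Q$ is the order type of the set of its proper predecessors, and for $\xi<\operatorname{ht}(t)$, $t\upharpoonright\xi$ is the unique predecessor of $t$ of height $\xi$. A subtree of $\sigma\mathbb Q$ is a set $T\subseteq\sigma\mathbb Q$ that is downward closed and such that every $s\in T$ has extensions in $T$ of arbitrarily large height below $\omega_1$. A subtree $T$ is special if there is a map $g:T\to\omega$ with $g(s)\neq g(t)$ whenever $s<t$ are in $T$ (equivalently, $T$ is a union of countably many antichains). A ladder system on $\omega_1$ is a sequence $\mathbf C=(C_\alpha)$, indexed by the countable (nonzero) limit ordinals $\alpha$, where each $C_\alpha$ is a cofinal subset of $\alpha$ of order type $\omega$; an $\omega$-colouring of $\mathbf C$ is a sequence $\mathbf f=(f_\alpha)$ of maps $f_\alpha:C_\alpha\to\omega$. There is a map $h:\sigma\mathbb Q\to\omega$ such that for every ladder system $\mathbf C$ on $\omega_1$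 and every $\omega$-colouring $\mathbf f$ of $\mathbf C$ there is a non-special subtree $T\subseteq\sigma\mathbb Q$ such that $h\upharpoonright T$ uniformizes $\mathbf f$: for every $t\in T$ of limit height $\alpha<\omega_1$, $h(t\upharpoonright\xi)=f_\alpha(\xi)$ for all but finitely many $\xi\in C_\alpha$. -/

import Mathlib

open Set Ordinal

/-- A set-theoretic tree: a partial order in which the set of predecessors
`t↓ = {s | s < t}` of every `t` is well ordered. -/
class IsOrderTree (T : Type) [PartialOrder T] : Prop where
  isWellOrder_pred : ∀ t : T, IsWellOrder (Iio t) (· < ·)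

attribute [instance] IsOrderTree.isWellOrder_pred

namespace IsOrderTree

variable {T : Type} [PartialOrder T] [IsOrderTree T]

/-- The height of `t`: the order type of the set of its predecessors. -/
noncomputable def ht (t : T) : Ordinal.{0} :=
  Ordinal.type (fun x y : Iio t => x < y)

open scoped Classical in
/-- `restrict t ξ` is `t ↾ ξ`, the predecessor of `t` of height `ξ`, for `ξ < ht t`
(see `restrict_lt`, `ht_restrict`, `eq_restrict`); for other `ξ` it is `t`, which plays no role. -/
noncomputable def restrict (t : T) (ξ : Ordinal.{0}) : T :=
  if h : ξ < ht t then (Ordinal.enum (fun x y : Iio t => x < y) ⟨ξ, h⟩).1 else t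

theorem restrict_lt {t : T} {ξ : Ordinal.{0}} (h : ξ < ht t) : restrict t ξ < t := by
  rw [restrict, dif_pos h]
  exact (Ordinal.enum (fun x y : Iio t => x < y) ⟨ξ, h⟩).2

/-- The height of a predecessor `s` of `t` is its position among the predecessors of `t`. -/
theorem ht_eq_typein {t : T} (s : Iio t) :
    ht s.1 = Ordinal.typein (fun x y : Iio t => x < y) s := by
  unfold ht
  rw [← Ordinal.type_subrel]
  refine Ordinal.type_eq.2 ⟨⟨⟨fun x => ⟨⟨x.1, lt_trans x.2 s.2⟩, x.2⟩,
    fun x => ⟨x.1.1, x.2⟩, fun _ => rfl, fun _ => rfl⟩, Iff.rfl⟩⟩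

theorem ht_restrict {t : T} {ξ : Ordinal.{0}} (h : ξ < ht t) : ht (restrict t ξ) = ξ := by
  rw [restrict, dif_pos h, ht_eq_typein]
  exact Ordinal.typein_enum _ h

theorem eq_restrict {s t : T} (h : s < t) : restrict t (ht s) = s := by
  have e := ht_eq_typein (t := t) ⟨s, h⟩
  have h' : ht s < ht t := by
    rw [e]
    exact Ordinal.typein_lt_type _ _
  rw [restrict, dif_pos h']
  have : (⟨ht s, h'⟩ : Iio (Ordinal.type (fun x y : Iio t => x < y))) =
      ⟨Ordinal.typein (fun x y : Iio t => x < y) ⟨s, h⟩, Ordinal.typein_lt_type _ _⟩ :=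
    Subtype.ext e
  rw [this, Ordinal.enum_typein]

/-- `S` is a subtree of the tree `T` of height `ω₁`: it is downward closed, and pruned in `T`,
i.e. every element of `S` has extensions in `S` of arbitrarily large height below `ω₁`. -/
def IsSubtree (S : Set T) : Prop :=
  IsLowerSet S ∧ ∀ s ∈ S, ∀ β < ω₁, ∃ t ∈ S, s ≤ t ∧ β ≤ ht t

/-- `S` is special: it is a union of countably many antichains, i.e. there is a map `S → ω`
which takes different values at any two different comparable elements. -/
def IsSpecial (S : Set T) : Prop :=
  ∃ g : S → ℕ, ∀ s t : S, s < t → g s ≠ g t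

end IsOrderTree

/-- The set `lim ω₁` of countable (nonzero) limit ordinals. -/
abbrev LimOmegaOne : Type 1 := {α : Ordinal.{0} // α < ω₁ ∧ Order.IsSuccLimit α}

/-- A ladder system on `ω₁`: for each `α ∈ lim ω₁` a cofinal subset of `α` of order type `ω`. -/
structure LadderSystem where
  ladder : LimOmegaOne → Set Ordinal.{0}
  lt_of_mem : ∀ α, ∀ ξ ∈ ladder α, ξ < α.1
  cofinal : ∀ α : LimOmegaOne, ∀ β < α.1, ∃ ξ ∈ ladder α, β ≤ ξ
  type_omega : ∀ α, Nonempty (ℕ ≃o ladder α)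

/-- An `ω`-colouring of a ladder system: a sequence of maps `f_α : C_α → ω`. -/
abbrev LadderSystem.Colouring (C : LadderSystem) : Type 1 :=
  (α : LimOmegaOne) → C.ladder α → ℕ

open IsOrderTree in
/-- The restriction of `h` to `S` is a `T`-uniformization of the colouring `f` of `C`: `S` is a
subtree of `T`, and for all `s ∈ S` of limit height `α < ω₁` we have `h (s ↾ ξ) = f_α ξ` for all
but finitely many `ξ ∈ C_α`. (As `S` is downward closed, only values of `h` on `S` occur.) -/
def UniformizesOn {T : Type} [PartialOrder T] [IsOrderTree T] (C : LadderSystem)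
    (f : C.Colouring) (h : T → ℕ) (S : Set T) : Prop :=
  IsSubtree S ∧ ∀ s ∈ S, ∀ α : LimOmegaOne, ht s = α.1 →
    {ξ : C.ladder α | h (restrict s ξ.1) ≠ f α ξ}.Finite

/-- `σℚ`: the well-ordered bounded sets of rationals, in other words the bounded strictly
increasing well-ordered sequences of rationals, including the empty one. (A well-ordered set of
rationals is always bounded below.) -/
@[ext] structure SigmaQ where
  carrier : Set ℚ
  isWF : carrier.IsWF
  bddAbove : BddAbove carrier

namespace SigmaQ

/-- `σℚ` is ordered by end extension. -/
instance : PartialOrder SigmaQ where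
  le s t := s.carrier ⊆ t.carrier ∧ ∀ x ∈ s.carrier, ∀ y ∈ t.carrier, y ∉ s.carrier → x < y
  le_refl s := ⟨Subset.rfl, fun _ _ _ hy h => absurd hy h⟩
  le_trans r s t h₁ h₂ := by
    refine ⟨h₁.1.trans h₂.1, fun x hx y hy hyr => ?_⟩
    by_cases hys : y ∈ s.carrier
    · exact h₁.2 x hx y hys hyr
    · exact h₂.2 x (h₁.1 hx) y hy hys
  le_antisymm s t h₁ h₂ := SigmaQ.ext (h₁.1.antisymm h₂.1)

theorem le_def {s t : SigmaQ} : s ≤ t ↔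
    s.carrier ⊆ t.carrier ∧ ∀ x ∈ s.carrier, ∀ y ∈ t.carrier, y ∉ s.carrier → x < y := Iff.rfl

theorem le_of_subset {r s t : SigmaQ} (hr : r ≤ t) (hs : s ≤ t) (h : r.carrier ⊆ s.carrier) :
    r ≤ s :=
  ⟨h, fun x hx y hy hyr => hr.2 x hx y (hs.1 hy) hyr⟩

theorem total_of_le {r s t : SigmaQ} (hr : r ≤ t) (hs : s ≤ t) : r ≤ s ∨ s ≤ r := by
  by_cases h : r.carrier ⊆ s.carrier
  · exact Or.inl (le_of_subset hr hs h)
  · refine Or.inr (le_of_subset hs hr fun y hy => ?_)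
    obtain ⟨x, hx, hxs⟩ := not_subset.1 h
    by_contra hyr
    exact lt_asymm (hr.2 x hx y (hs.1 hy) hyr) (hs.2 y hy x (hr.1 hx) hxs)

theorem diff_nonempty {s t : SigmaQ} (h : s < t) : (t.carrier \ s.carrier).Nonempty := by
  by_contra h'
  refine h.ne (SigmaQ.ext (h.le.1.antisymm fun y hy => ?_))
  by_contra hys
  exact h' ⟨y, hy, hys⟩

instance : IsOrderTree SigmaQ where
  isWellOrder_pred t := by
    have hle : ∀ s : Iio t, s.1 ≤ t := fun s => le_of_lt (mem_Iio.1 s.2)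
    have key : ∀ s : Iio t, ∃ q : t.carrier, q.1 ∉ s.1.carrier ∧
        ∀ y ∈ t.carrier, y ∉ s.1.carrier → q.1 ≤ y := fun s => by
      have hw : (t.carrier \ s.1.carrier).IsWF := t.isWF.mono fun _ hx => hx.1
      have hne := diff_nonempty (mem_Iio.1 s.2)
      have hm := hw.min_mem hne
      exact ⟨⟨_, hm.1⟩, hm.2, fun y hy hys => hw.min_le hne ⟨hy, hys⟩⟩
    choose m hm hmin using key
    have hwf : WellFounded (fun x y : Iio t => x < y) := by
      refine Subrelation.wf (r := InvImage (· < ·) m) ?_ (InvImage.wf m ?_)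
      · intro a b hab
        have hab' : a.1 < b.1 := hab
        obtain ⟨y, hyb, hya⟩ := diff_nonempty hab'
        have h1 := hmin a y ((hle b).1 hyb) hya
        have h2 := (hle b).2 y hyb (m b).1 (m b).2 (hm b)
        exact Subtype.coe_lt_coe.1 (lt_of_le_of_lt h1 h2)
      · exact t.isWF
    have htot : ∀ a b : Iio t, a < b ∨ a = b ∨ b < a := fun a b => by
      rcases total_of_le (hle a) (hle b) with h | h
      · rcases h.lt_or_eq with h | h
        · exact Or.inl h
        · exact Or.inr (Or.inl (Subtype.ext h))
      · rcases h.lt_or_eq with h | h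
        · exact Or.inr (Or.inr h)
        · exact Or.inr (Or.inl (Subtype.ext h.symm))
    exact { wf := hwf, trichotomous := fun a b h1 h2 => ((htot a b).resolve_left h1).resolve_right h2 }

end SigmaQ

/-!
Fix a colouring `e : ℚ → ℕ` with dense fibres, and let `h t` be the colour of `sup t`
(`SigmaQ.supColour`). Given `C` and `f`, the tree `T` is the largest candidate: all `t` such that
`t` and all its predecessors of limit height satisfy the condition imposed by `f`
(`uniformizingSet`).

*`T` is a subtree.* Since the fibres of `e` are dense, every `t ∈ T` extends to any larger
countable height `ξ`, with a supremum of any given colour in any given interval above `t`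
(`exists_extension`). This is proved by induction on `ξ`; if `ξ` is a limit, one climbs along the
ladder at `ξ`, at each rung choosing a supremum of the prescribed colour, so that the suprema
converge to a rational of the desired colour.

*`T` is not special.* Let `g : T → ℕ` be given. For `t ∈ T` below a rational `b` and a colour `m`,
one can pass to an extension of `t` below `b` which either has colour `m` or has no extension below
`b` of colour `m`. Doing this for every `m` in turn gives a sequence whose union `u` cannot have any
colour, if only `u ∈ T`. But the height of the extensions that decide `m` is not under control, and
they might jump over points of the ladder at `ht u`, violating the condition there. The remedy is to
work with closure points: a countable ordinal `δ` such that everything obtained from the empty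
sequence by the chosen extension operations, with ordinal parameters below `δ`, has height below
`δ` (`Reachable.exists_closed`). Take an increasing sequence of closure points `δ n` with supremum
`α`. Stage `n` starts below height `δ n`. It first extends through the finitely many points of the
ladder at `α` in the interval `[δ n, δ (n + 1))`, with the right colours
(`exists_extension_finset`), and then decides the colour `n`. The deciding extension has height
below `δ (n + 1)`, so no further point of the ladder is passed.
-/

/-! ### Heights in trees, and extensions in `σℚ` -/

namespace IsOrderTree

variable {T : Type} [PartialOrder T] [IsOrderTree T]

theorem ht_lt_ht {s t : T} (h : s < t) : ht s < ht t := by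
  rw [ht_eq_typein (t := t) ⟨s, h⟩]
  exact Ordinal.typein_lt_type _ _

theorem ht_le_ht {s t : T} (h : s ≤ t) : ht s ≤ ht t := by
  rcases h.eq_or_lt with rfl | h
  · exact le_rfl
  · exact (ht_lt_ht h).le

theorem ht_le_of_forall_lt {t : T} {γ : Ordinal.{0}} (h : ∀ s < t, ht s < γ) : ht t ≤ γ := by
  by_contra! hlt
  exact (h _ (restrict_lt hlt)).ne (ht_restrict hlt)

end IsOrderTree

namespace SigmaQ

open IsOrderTree


theorem ht_lt_omega_one (t : SigmaQ) : ht t < ω₁ := by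
  have hw : ∀ s : Iio t, (t.carrier \ s.1.carrier).IsWF := fun s => t.isWF.mono fun _ hx => hx.1
  have hne : ∀ s : Iio t, (t.carrier \ s.1.carrier).Nonempty := fun s => diff_nonempty s.2
  -- A proper initial segment is recovered from the least element that it omits.
  have hlt : ∀ a b : Iio t, a.1 < b.1 → (hw a).min (hne a) < (hw b).min (hne b) := by
    intro a b hab
    obtain ⟨y, hyb, hya⟩ := diff_nonempty hab
    have hb := (hw b).min_mem (hne b)
    have hbt : b.1 ≤ t := (show b.1 < t from b.2).le
    exact ((hw a).min_le (hne a) ⟨hbt.1 hyb, hya⟩).trans_lt (hbt.2 y hyb _ hb.1 hb.2)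
  have hinj : Function.Injective fun s : Iio t => (hw s).min (hne s) := by
    intro a b hab
    have hat : a.1 ≤ t := (show a.1 < t from a.2).le
    have hbt : b.1 ≤ t := (show b.1 < t from b.2).le
    rcases total_of_le hat hbt with h | h
    · rcases h.lt_or_eq with h | h
      · exact absurd hab (hlt a b h).ne
      · exact Subtype.ext h
    · rcases h.lt_or_eq with h | h
      · exact absurd hab (hlt b a h).ne'
      · exact Subtype.ext h.symm
  have : Countable (Iio t) := hinj.countable
  rw [ht, ← Cardinal.ord_aleph, Cardinal.lt_ord, Ordinal.card_type, Cardinal.lt_aleph_one_iff]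
  exact Cardinal.mk_le_aleph0

/-- The empty sequence of rationals, the root of `σℚ`. -/
def root : SigmaQ := ⟨∅, Set.isWF_empty, bddAbove_empty⟩

theorem not_lt_root (s : SigmaQ) : ¬ s < root := fun h => (diff_nonempty h).some_mem.1

theorem ht_root : ht root = 0 :=
  nonpos_iff_eq_zero.1 (ht_le_of_forall_lt fun s hs => absurd hs (not_lt_root s))

/-- Every `t ∈ σℚ` has an immediate successor obtained by adding a rational `q` above all
elements of `t`. -/
theorem exists_insert {t : SigmaQ} {q : ℚ} (hq : ∀ x ∈ t.carrier, x < q) :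
    ∃ u : SigmaQ, t ≤ u ∧ (∀ s < u, s ≤ t) ∧ ht u = ht t + 1 ∧ IsLUB u.carrier q := by
  let u : SigmaQ := ⟨insert q t.carrier, t.isWF.insert q, t.bddAbove.insert q⟩
  have htu : t ≤ u := by
    refine ⟨subset_insert _ _, fun x hx y hy hyt => ?_⟩
    rcases hy with rfl | hy
    · exact hq x hx
    · exact absurd hy hyt
  have hqt : q ∉ t.carrier := fun h => (hq q h).false
  have htu' : t < u := htu.lt_of_ne fun h => hqt (h ▸ mem_insert q t.carrier)
  have hpred : ∀ s < u, s ≤ t := by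
    intro s hs
    refine le_of_subset hs.le htu fun x hx => ?_
    rcases hs.le.1 hx with rfl | hxt
    · obtain ⟨y, hyu, hys⟩ := diff_nonempty hs
      have hxy := hs.le.2 x hx y hyu hys
      rcases hyu with rfl | hyt
      · exact absurd hx hys
      · exact absurd (hq y hyt) hxy.not_gt
    · exact hxt
  refine ⟨u, htu, hpred, le_antisymm ?_ ?_, ?_⟩
  · exact ht_le_of_forall_lt fun s hs => Order.lt_add_one_iff.2 (ht_le_ht (hpred s hs))
  · exact Order.add_one_le_of_lt (ht_lt_ht htu')
  · refine IsGreatest.isLUB ⟨mem_insert _ _, ?_⟩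
    rintro x (rfl | hx)
    · exact le_rfl
    · exact (hq x hx).le

/-- A bounded increasing sequence in `σℚ` has its union as least upper bound. -/
theorem exists_iUnion {t : ℕ → SigmaQ} (hmono : Monotone t) {b : ℚ}
    (hb : ∀ n, b ∈ upperBounds (t n).carrier) :
    ∃ u : SigmaQ, u.carrier = ⋃ n, (t n).carrier ∧ (∀ n, t n ≤ u) ∧
      ∀ s < u, ∃ n, s ≤ t n := by
  have key : ∀ n, ∀ x ∈ (t n).carrier, ∀ y ∈ ⋃ n, (t n).carrier, y ∉ (t n).carrier → x < y := by
    intro n x hx y hy hyn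
    obtain ⟨m, hm⟩ := mem_iUnion.1 hy
    rcases le_total n m with h | h
    · exact (hmono h).2 x hx y hm hyn
    · exact absurd ((hmono h).1 hm) hyn
  have hwf : (⋃ n, (t n).carrier).IsWF := by
    refine Set.isWF_iff_no_descending_seq.2 fun f hf hmem => ?_
    obtain ⟨n, hn⟩ := mem_iUnion.1 (hmem 0)
    refine Set.isWF_iff_no_descending_seq.1 (t n).isWF f hf fun k => ?_
    by_contra hk
    exact (hf.antitone (Nat.zero_le k)).not_gt (key n _ hn _ (hmem k) hk)
  have hbd : BddAbove (⋃ n, (t n).carrier) := by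
    refine ⟨b, fun x hx => ?_⟩
    obtain ⟨n, hn⟩ := mem_iUnion.1 hx
    exact hb n hn
  have hle : ∀ n, t n ≤ (⟨_, hwf, hbd⟩ : SigmaQ) := fun n =>
    ⟨subset_iUnion (fun n => (t n).carrier) n, key n⟩
  refine ⟨⟨_, hwf, hbd⟩, rfl, hle, fun s hs => ?_⟩
  obtain ⟨y, hyu, hys⟩ := diff_nonempty hs
  obtain ⟨n, hn⟩ := mem_iUnion.1 hyu
  refine ⟨n, (total_of_le hs.le (hle n)).resolve_right fun h => hys (h.1 hn)⟩

theorem ht_eq_of_iUnion {t : ℕ → SigmaQ} {u : SigmaQ} {δ : Ordinal.{0}} (hle : ∀ n, t n ≤ u)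
    (hlt : ∀ s < u, ∃ n, s ≤ t n) (hδ : ∀ n, ht (t n) < δ)
    (hcof : ∀ β < δ, ∃ n, β ≤ ht (t n)) (hlim : Order.IsSuccLimit δ) :
    ht u = δ := by
  refine le_antisymm (ht_le_of_forall_lt fun s hs => ?_) (le_of_forall_lt fun β hβ => ?_)
  · obtain ⟨n, hn⟩ := hlt s hs
    exact (ht_le_ht hn).trans_lt (hδ n)
  · obtain ⟨n, hn⟩ := hcof _ (hlim.succ_lt hβ)
    exact (Order.lt_succ β).trans_le (hn.trans (ht_le_ht (hle n)))

end SigmaQ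

open IsOrderTree

/-! ### Colouring the rationals and the universal map -/

/-- There is a colouring of the rationals by natural numbers all of whose fibres are dense. -/
theorem exists_dense_colouring :
    ∃ e : ℚ → ℕ, ∀ (a b : ℚ) (k : ℕ), a < b → ∃ q, a < q ∧ q < b ∧ e q = k := by
  -- The numbers `2 ^ k * (2 * i + 1) / 3 ^ n` have 2-adic valuation `k`.
  refine ⟨fun q => (padicValRat 2 q).toNat, fun a b k hab => ?_⟩
  have hd : 0 < (b - a) / (2 ^ k * 2) := div_pos (sub_pos.2 hab) (by positivity)
  obtain ⟨n, hn⟩ := exists_pow_lt_of_lt_one hd (show (1 / 3 : ℚ) < 1 by norm_num)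
  have h3 : (0 : ℚ) < 3 ^ n := by positivity
  have h2 : (0 : ℚ) < 2 ^ k := by positivity
  set i : ℤ := ⌊(a * 3 ^ n / 2 ^ k - 1) / 2⌋ + 1 with hi
  have h1 : (a * 3 ^ n / 2 ^ k - 1) / 2 < i := by rw [hi]; push_cast; exact Int.lt_floor_add_one _
  have h1' : (i : ℚ) ≤ (a * 3 ^ n / 2 ^ k - 1) / 2 + 1 := by
    rw [hi]; push_cast; gcongr; exact Int.floor_le _
  have hn' : 2 ^ k * 2 < (b - a) * 3 ^ n := by
    rw [lt_div_iff₀ (by positivity), div_pow, one_pow, div_mul_eq_mul_div, div_lt_iff₀ h3] at hn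
    linarith
  have hdiv : a * 3 ^ n / 2 ^ k * 2 ^ k = a * 3 ^ n := div_mul_cancel₀ _ h2.ne'
  refine ⟨2 ^ k * (2 * i + 1) / 3 ^ n, ?_, ?_, ?_⟩
  · rw [lt_div_iff₀ h3]
    have : a * 3 ^ n / 2 ^ k < 2 * i + 1 := by linarith
    have := mul_lt_mul_of_pos_left this h2
    linarith
  · rw [div_lt_iff₀ h3]
    have : (2 * i + 1 : ℚ) ≤ a * 3 ^ n / 2 ^ k + 2 := by linarith
    have := mul_le_mul_of_nonneg_left this h2.le
    linarith
  · have hne : ((2 * i + 1 : ℤ) : ℚ) ≠ 0 := by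
      exact_mod_cast (by omega : (2 * i + 1 : ℤ) ≠ 0)
    have e1 : padicValRat 2 (((2 * i + 1 : ℤ) : ℚ)) = 0 := by
      rw [padicValRat.of_int, padicValInt.eq_zero_of_not_dvd (by omega)]; rfl
    have e2 : padicValRat 2 ((3 : ℚ) ^ n) = 0 := by
      have : ¬ 2 ∣ 3 ^ n := fun h => absurd (Nat.prime_two.dvd_of_dvd_pow h) (by norm_num)
      rw [show (3 : ℚ) ^ n = ((3 ^ n : ℕ) : ℚ) by norm_num, padicValRat.of_nat,
        padicValNat.eq_zero_of_not_dvd this]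
      rfl
    have e3 : padicValRat 2 ((2 : ℚ) ^ k) = k := by
      rw [show (2 : ℚ) ^ k = ((2 ^ k : ℕ) : ℚ) by norm_num, padicValRat.of_nat,
        padicValNat.prime_pow]
    have : padicValRat 2 (2 ^ k * (2 * i + 1) / 3 ^ n : ℚ) = k := by
      have : (2 * i + 1 : ℚ) = ((2 * i + 1 : ℤ) : ℚ) := by push_cast; ring
      rw [this, padicValRat.div (mul_ne_zero h2.ne' hne) h3.ne', padicValRat.mul h2.ne' hne,
        e1, e2, e3]
      simp
    simp only [this, Int.toNat_natCast]

namespace SigmaQ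

/-- Given a colouring `e` of the rationals, the supremum of `t ∈ σℚ` is given the colour it has
under `e`; the colour `0` for `t` without a rational supremum is an arbitrary choice. -/
noncomputable def supColour (e : ℚ → ℕ) (t : SigmaQ) : ℕ :=
  open scoped Classical in if h : ∃ q, IsLUB t.carrier q then e h.choose else 0

theorem supColour_eq {e : ℚ → ℕ} {t : SigmaQ} {q : ℚ} (hq : IsLUB t.carrier q) :
    supColour e t = e q := by
  have h : ∃ q, IsLUB t.carrier q := ⟨q, hq⟩
  rw [supColour, dif_pos h, h.choose_spec.unique hq]

end SigmaQ

/-! ### The tree of all uniformizing sequences -/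

/-- The largest downward closed set on which `h` can uniformize `f`: all `t` such that `t` and its
predecessors satisfy the condition that `f` imposes on elements of limit height. -/
def uniformizingSet (C : LadderSystem) (f : C.Colouring) (h : SigmaQ → ℕ) : Set SigmaQ :=
  {t | ∀ s ≤ t, ∀ α : LimOmegaOne, ht s = α.1 →
    {ξ : C.ladder α | h (restrict s ξ.1) ≠ f α ξ}.Finite}

theorem isLowerSet_uniformizingSet (C : LadderSystem) (f : C.Colouring) (h : SigmaQ → ℕ) :
    IsLowerSet (uniformizingSet C f h) :=
  fun _ _ hst ht r hr => ht r (hr.trans hst)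

theorem root_mem_uniformizingSet (C : LadderSystem) (f : C.Colouring) (h : SigmaQ → ℕ) :
    SigmaQ.root ∈ uniformizingSet C f h := by
  intro s hs α hα
  rcases hs.eq_or_lt with rfl | hs
  · rw [SigmaQ.ht_root] at hα
    exact absurd hα α.2.2.bot_lt.ne
  · exact absurd hs (SigmaQ.not_lt_root s)

theorem LadderSystem.finite_lt (C : LadderSystem) (α : LimOmegaOne) {β : Ordinal.{0}}
    (hβ : β < α.1) : {ξ ∈ C.ladder α | ξ < β}.Finite := by
  obtain ⟨c⟩ := C.type_omega α
  obtain ⟨γ, hγ, hβγ⟩ := C.cofinal α β hβ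
  refine ((finite_Iio (c.symm ⟨γ, hγ⟩)).image fun n => (c n).1).subset ?_
  rintro ξ ⟨hξ, hlt⟩
  refine ⟨c.symm ⟨ξ, hξ⟩, c.symm.strictMono (Subtype.mk_lt_mk.2 (hlt.trans_le hβγ)), by simp⟩

/-- A sequence built by dependent choice along an indexed family of properties. -/
theorem exists_seq_of_step {X : Type*} {P : ℕ → X → Prop} {R : ℕ → X → X → Prop}
    (h0 : ∃ x, P 0 x) (hstep : ∀ n x, P n x → ∃ y, P (n + 1) y ∧ R n x y) :
    ∃ s : ℕ → X, ∀ n, P n (s n) ∧ R n (s n) (s (n + 1)) := by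
  obtain ⟨x, hx⟩ := h0
  choose F hP hR using hstep
  let s : ∀ n, {x // P n x} := fun n =>
    Nat.rec ⟨x, hx⟩ (fun n y => ⟨F n y.1 y.2, hP n y.1 y.2⟩) n
  exact ⟨fun n => (s n).1, fun n => ⟨(s n).2, hR n (s n).1 (s n).2⟩⟩

/-- An extension `u` of limit height of a sequence of elements of the uniformizing set lies in it
if, up to finitely many exceptions, the colours prescribed by `f` along the ladder are taken
by predecessors of `u`. -/
theorem mem_uniformizingSet_of_iUnion {C : LadderSystem} {f : C.Colouring} {h : SigmaQ → ℕ}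
    {t : ℕ → SigmaQ} {u : SigmaQ} (α : LimOmegaOne) (hu : ht u = α.1)
    (hlt : ∀ s < u, ∃ n, s ≤ t n) (hmem : ∀ n, t n ∈ uniformizingSet C f h)
    {β : Ordinal.{0}} (hβ : β < α.1)
    (hcol : ∀ ξ : C.ladder α, β ≤ ξ.1 → ∃ s ≤ u, ht s = ξ.1 ∧ h s = f α ξ) :
    u ∈ uniformizingSet C f h := by
  intro s hs γ hγ
  rcases hs.eq_or_lt with rfl | hs
  · obtain rfl : γ = α := Subtype.ext (hγ.symm.trans hu)
    refine ((C.finite_lt γ hβ).preimage Subtype.val_injective.injOn).subset fun ξ hξ => ?_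
    refine ⟨ξ.2, ?_⟩
    by_contra! hle
    obtain ⟨r, hr, hrξ, hrf⟩ := hcol ξ hle
    have hru : r < s := hr.lt_of_ne fun hrs => (C.lt_of_mem γ ξ.1 ξ.2).ne (by rw [← hrξ, hrs, hu])
    refine hξ ?_
    rw [← hrξ, eq_restrict hru, hrf]
  · obtain ⟨n, hn⟩ := hlt s hs
    exact hmem n s hn γ hγ

/-- The extension property: inside the uniformizing set, every `t` extends to any larger
countable height, with a supremum of any prescribed colour in any prescribed interval above `t`. -/
theorem exists_extension {e : ℚ → ℕ}
    (he : ∀ (a b : ℚ) (k : ℕ), a < b → ∃ q, a < q ∧ q < b ∧ e q = k)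
    (C : LadderSystem) (f : C.Colouring) {ξ : Ordinal.{0}} (hξ : ξ < ω₁) :
    ∀ t ∈ uniformizingSet C f (SigmaQ.supColour e), ∀ (a b : ℚ) (k : ℕ), ht t < ξ →
      a ∈ upperBounds t.carrier → a < b →
      ∃ u ∈ uniformizingSet C f (SigmaQ.supColour e), t ≤ u ∧ ht u = ξ ∧
        ∃ q, IsLUB u.carrier q ∧ a < q ∧ q < b ∧ e q = k := by
  induction ξ using WellFoundedLT.induction with
  | ind ξ ih =>
  intro t ht_mem a b k htξ ha hab
  rcases Ordinal.zero_or_succ_or_isSuccLimit ξ with rfl | ⟨η, rfl⟩ | hlim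
  · exact absurd htξ not_lt_zero
  · -- Extend to height `η` first, and then add one rational of the right colour.
    have hη : η < Order.succ η := Order.lt_succ η
    obtain ⟨t₁, ht₁, htt₁, hη₁, a₁, ha₁, haa₁, hab₁⟩ :
        ∃ t₁ ∈ uniformizingSet C f (SigmaQ.supColour e), t ≤ t₁ ∧ ht t₁ = η ∧
          ∃ a₁ ∈ upperBounds t₁.carrier, a ≤ a₁ ∧ a₁ < b := by
      rcases (Order.lt_succ_iff.1 htξ).eq_or_lt with h | h
      · exact ⟨t, ht_mem, le_rfl, h, a, ha, le_rfl, hab⟩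
      · obtain ⟨u, hu, htu, huη, q, hq, haq, hqb, -⟩ :=
          ih η hη (hη.trans hξ) t ht_mem a b 0 h ha hab
        exact ⟨u, hu, htu, huη, q, hq.1, haq.le, hqb⟩
    obtain ⟨q, haq, hqb, hqk⟩ := he a₁ b k hab₁
    obtain ⟨u, hu, hpred, hhu, hlub⟩ :=
      SigmaQ.exists_insert (t := t₁) (q := q) fun x hx => (ha₁ hx).trans_lt haq
    refine ⟨u, ?_, htt₁.trans hu, by rw [hhu, hη₁, Order.succ_eq_add_one], q, hlub,
      haa₁.trans_lt haq, hqb, hqk⟩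
    intro s hs γ hγ
    rcases hs.eq_or_lt with rfl | hs
    · have := γ.2.2
      rw [← hγ, hhu, ← Order.succ_eq_add_one] at this
      exact absurd this (Order.not_isSuccLimit_succ _)
    · exact ht₁ s (hpred s hs) γ hγ
  · -- Climb along the ladder at `ξ`, while the suprema converge to a rational `x` of colour `k`.
    obtain ⟨x, hax, hxb, hxk⟩ := he a b k hab
    let α : LimOmegaOne := ⟨ξ, hξ, hlim⟩
    obtain ⟨c⟩ := C.type_omega α
    obtain ⟨γ, hγ, htγ⟩ := C.cofinal α _ (hlim.succ_lt htξ)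
    set N := c.symm ⟨γ, hγ⟩ with hN
    have hcN : (c N).1 = γ := by simp [hN]
    have hcξ : ∀ n, (c n).1 < ξ := fun n => C.lt_of_mem α _ (c n).2
    have hcmono : ∀ m n, m < n → (c m).1 < (c n).1 := fun m n h => c.strictMono h
    let X : ℕ → ℚ := fun n => x - (x - a) / (n + 1)
    have hX0 : X 0 = a := by simp [X]
    have hXlt : ∀ n, X n < X (n + 1) := fun n => by
      have : 0 < x - a := sub_pos.2 hax
      simp only [X]
      gcongr
      simp
    have hXx : ∀ n, X n < x := fun n => by
      have : 0 < (x - a) / ((n : ℚ) + 1) := div_pos (sub_pos.2 hax) (by positivity)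
      simp only [X]; linarith
    let P : ℕ → SigmaQ → Prop := fun n s =>
      s ∈ uniformizingSet C f (SigmaQ.supColour e) ∧ t ≤ s ∧ ht s = (c (N + n)).1 ∧
        ∃ q, IsLUB s.carrier q ∧ X n < q ∧ q < X (n + 1) ∧ e q = f α (c (N + n))
    have h0 : ∃ s, P 0 s := by
      refine ih _ (hcξ _) ((hcξ _).trans hξ) t ht_mem (X 0) (X 1) _ ?_ (hX0 ▸ ha) (hXlt 0)
      rw [Nat.add_zero, hcN]
      exact (Order.lt_succ _).trans_le htγ
    have hstep : ∀ n s, P n s → ∃ s', P (n + 1) s' ∧ s ≤ s' := by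
      rintro n s ⟨hs, hts, hsc, q, hq, -, hqX, -⟩
      obtain ⟨u, hu, hsu, h⟩ := ih _ (hcξ (N + (n + 1))) ((hcξ _).trans hξ) s hs (X (n + 1))
        (X (n + 1 + 1)) (f α (c (N + (n + 1)))) (hsc ▸ hcmono _ _ (by omega))
        (fun y hy => (hq.1 hy).trans hqX.le) (hXlt _)
      exact ⟨u, ⟨hu, hts.trans hsu, h⟩, hsu⟩
    obtain ⟨s, hs⟩ := exists_seq_of_step h0 hstep
    have hmono : Monotone s := monotone_nat_of_le_succ fun n => (hs n).2
    have hsx : ∀ n, x ∈ upperBounds (s n).carrier := fun n y hy => by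
      obtain ⟨q, hq, -, hqX, -⟩ := (hs n).1.2.2.2
      exact (hq.1 hy).trans (hqX.trans (hXx _)).le
    obtain ⟨u, hucar, hsu, hpred⟩ := SigmaQ.exists_iUnion hmono hsx
    have huξ : ht u = ξ := by
      refine SigmaQ.ht_eq_of_iUnion hsu hpred (fun n => (hs n).1.2.2.1 ▸ hcξ _) (fun β hβ => ?_) hlim
      obtain ⟨δ, hδ, hβδ⟩ := C.cofinal α β hβ
      refine ⟨c.symm ⟨δ, hδ⟩, ?_⟩
      rw [(hs _).1.2.2.1]
      refine hβδ.trans ?_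
      have : c (c.symm ⟨δ, hδ⟩) ≤ c (N + c.symm ⟨δ, hδ⟩) := c.monotone (Nat.le_add_left _ _)
      simpa using Subtype.coe_le_coe.2 this
    refine ⟨u, ?_, (hs 0).1.2.1.trans (hsu 0), huξ, x, ?_, hax, hxb, hxk⟩
    · refine mem_uniformizingSet_of_iUnion α huξ hpred (fun n => (hs n).1.1) (hcξ N) fun η hη => ?_
      have hNη : N ≤ c.symm η := (OrderIso.le_symm_apply c).2 hη
      obtain ⟨n, hn⟩ := Nat.exists_eq_add_of_le hNη
      have hcn : c (N + n) = η := by rw [← hn]; simp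
      obtain ⟨-, -, hsn, q, hq, -, -, hqf⟩ := (hs n).1
      exact ⟨s n, hsu n, by rw [hsn, hcn], by rw [SigmaQ.supColour_eq hq, hqf, hcn]⟩
    · refine ⟨fun y hy => ?_, fun y hy => ?_⟩
      · rw [hucar] at hy
        obtain ⟨n, hn⟩ := mem_iUnion.1 hy
        exact hsx n hn
      · by_contra! hyx
        obtain ⟨n, hn⟩ := exists_nat_gt ((x - a) / (x - y))
        obtain ⟨q, hq, hXq, -⟩ := (hs n).1.2.2.2
        have hqy : q ≤ y := hq.2 fun z hz => hy ((hsu n).1 hz)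
        have hxy : 0 < x - y := sub_pos.2 hyx
        have h1 : (x - a) / ((n : ℚ) + 1) < x - y := by
          rw [div_lt_iff₀ hxy] at hn
          rw [div_lt_iff₀ (by positivity)]
          nlinarith
        have h2 : X n < y := hXq.trans_le hqy
        simp only [X] at h2
        linarith

theorem isSubtree_uniformizingSet {e : ℚ → ℕ}
    (he : ∀ (a b : ℚ) (k : ℕ), a < b → ∃ q, a < q ∧ q < b ∧ e q = k)
    (C : LadderSystem) (f : C.Colouring) :
    IsSubtree (uniformizingSet C f (SigmaQ.supColour e)) := by
  refine ⟨isLowerSet_uniformizingSet C f _, fun s hs β hβ => ?_⟩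
  rcases le_or_gt β (ht s) with h | h
  · exact ⟨s, hs, le_rfl, h⟩
  · obtain ⟨a, ha⟩ := s.bddAbove
    obtain ⟨u, hu, hsu, huβ, -⟩ := exists_extension he C f hβ s hs a (a + 1) 0 h ha (lt_add_one a)
    exact ⟨u, hu, hsu, huβ.ge⟩

/-! ### Closure points of countable families of operations -/

/-- The elements obtained from `x₀` by finitely many applications of the
operations `op i ξ` with ordinal parameter `ξ < β`. -/
inductive Reachable {X ι : Type} (op : ι → Ordinal.{0} → X → X) (x₀ : X) (β : Ordinal.{0}) :
    X → Prop
  | base : Reachable op x₀ β x₀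
  | step (i : ι) {ξ : Ordinal.{0}} (hξ : ξ < β) {x : X} (hx : Reachable op x₀ β x) :
      Reachable op x₀ β (op i ξ x)

namespace Reachable

variable {X ι : Type} {op : ι → Ordinal.{0} → X → X} {x₀ : X}

theorem mono {β γ : Ordinal.{0}} (hβγ : β ≤ γ) {x : X} (hx : Reachable op x₀ β x) :
    Reachable op x₀ γ x := by
  induction hx with
  | base => exact base
  | step i hξ _ ih => exact step i (hξ.trans_le hβγ) ih

theorem countable [Countable ι] {β : Ordinal.{0}} (hβ : β < ω₁) :
    {x | Reachable op x₀ β x}.Countable := by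
  have hIio : (Iio β).Countable := by
    rw [← Cardinal.le_aleph0_iff_set_countable, Cardinal.mk_Iio_ordinal, Cardinal.lift_le_aleph0,
      ← Cardinal.lt_aleph_one_iff, ← Cardinal.lt_ord, Cardinal.ord_aleph]
    exact hβ
  let A : ℕ → Set X := fun n =>
    Nat.rec {x₀} (fun _ S => ⋃ i, ⋃ ξ ∈ Iio β, op i ξ '' S) n
  have hA : ∀ n, (A n).Countable := by
    intro n
    induction n with
    | zero => exact countable_singleton x₀
    | succ n ih =>
      exact countable_iUnion fun i => hIio.biUnion fun ξ _ => ih.image (op i ξ)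
  refine (countable_iUnion hA).mono fun x (hx : Reachable op x₀ β x) => ?_
  induction hx with
  | base => exact mem_iUnion.2 ⟨0, rfl⟩
  | @step i ξ hξ x hx ih =>
    obtain ⟨n, hn⟩ := mem_iUnion.1 ih
    exact mem_iUnion.2 ⟨n + 1, mem_iUnion.2 ⟨i, mem_iUnion₂.2 ⟨ξ, hξ, mem_image_of_mem _ hn⟩⟩⟩

/-- The ordinals `δ` such that everything reachable with parameters below `δ` has rank below `δ`
are unbounded in `ω₁`. -/
theorem exists_closed [Countable ι] {rk : X → Ordinal.{0}} (hrk : ∀ x, rk x < ω₁)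
    {β : Ordinal.{0}} (hβ : β < ω₁) :
    ∃ δ < ω₁, β < δ ∧ ∀ x, Reachable op x₀ δ x → rk x < δ := by
  have hbound : ∀ γ, ∃ γ', γ < ω₁ → γ' < ω₁ ∧ γ < γ' ∧ ∀ x, Reachable op x₀ γ x → rk x < γ' := by
    intro γ
    by_cases hγ : γ < ω₁
    · have hlim := Cardinal.isSuccLimit_omega 1
      have : Countable {x | Reachable op x₀ γ x} := (countable hγ).to_subtype
      let σ := ⨆ x : {x | Reachable op x₀ γ x}, rk x.1
      have hσ : σ < ω₁ := iSup_lt_omega_one fun x => hrk x.1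
      refine ⟨Order.succ (max σ γ), fun _ => ⟨hlim.succ_lt (max_lt hσ hγ),
        Order.lt_succ_iff.2 (le_max_right _ _), fun x hx => Order.lt_succ_iff.2 ?_⟩⟩
      exact (Ordinal.le_iSup (fun x : {x | Reachable op x₀ γ x} => rk x.1) ⟨x, hx⟩).trans
        (le_max_left _ _)
    · exact ⟨0, fun h => absurd h hγ⟩
  choose φ hφ using hbound
  let γ : ℕ → Ordinal.{0} := fun n => φ^[n] β
  have hγs : ∀ n, γ (n + 1) = φ (γ n) := fun n => Function.iterate_succ_apply' φ n β
  have hγ : ∀ n, γ n < ω₁ := by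
    intro n
    induction n with
    | zero => exact hβ
    | succ n ih => rw [hγs]; exact (hφ _ ih).1
  have hγlt : ∀ n, γ n < γ (n + 1) := fun n => by rw [hγs]; exact (hφ _ (hγ n)).2.1
  have hmono : Monotone γ := monotone_nat_of_le_succ fun n => (hγlt n).le
  have hsup : ∀ n, γ n < ⨆ n, γ n := fun n => (hγlt n).trans_le (Ordinal.le_iSup γ (n + 1))
  refine ⟨⨆ n, γ n, iSup_lt_omega_one hγ, hsup 0, fun x hx => ?_⟩
  have hcont : ∃ n, Reachable op x₀ (γ n) x := by
    induction hx with
    | base => exact ⟨0, base⟩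
    | step i hξ _ ih =>
      obtain ⟨n, hn⟩ := ih
      obtain ⟨m, hm⟩ := Ordinal.lt_iSup_iff.1 hξ
      exact ⟨max m n, step i (hm.trans_le (hmono (le_max_left m n)))
        (hn.mono (hmono (le_max_right m n)))⟩
  obtain ⟨n, hn⟩ := hcont
  refine lt_of_lt_of_le ?_ (Ordinal.le_iSup γ (n + 1))
  rw [hγs]
  exact (hφ _ (hγ n)).2.2 x hn

end Reachable

/-! ### Non-speciality -/

namespace SigmaQ

/-- `t` lies strictly below `b`: its elements are bounded by some rational `q < b`. -/
def StrictlyBelow (t : SigmaQ) (b : ℚ) : Prop :=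
  ∃ q ∈ upperBounds t.carrier, q < b

end SigmaQ

/-- Iterating one-step extensions, `t` can be extended through finitely many prescribed heights
with prescribed colours, staying in a set `K` closed under the one-step extensions. -/
theorem exists_extension_finset {h : SigmaQ → ℕ} {K : Set SigmaQ} {b : ℚ} {δ : Ordinal.{0}}
    (F : Ordinal.{0} → ℕ)
    (hK : ∀ t ∈ K, t.StrictlyBelow b → ∀ ξ < δ, ht t < ξ →
      ∃ u ∈ K, t ≤ u ∧ u.StrictlyBelow b ∧ ht u = ξ ∧ h u = F ξ)
    {t : SigmaQ} (htK : t ∈ K) (htb : t.StrictlyBelow b) (S : Finset Ordinal.{0})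
    (hS : ∀ ξ ∈ S, ht t < ξ ∧ ξ < δ) :
    ∃ u ∈ K, t ≤ u ∧ u.StrictlyBelow b ∧ ∀ ξ ∈ S, ∃ s ≤ u, ht s = ξ ∧ h s = F ξ := by
  suffices H : ∃ u ∈ K, t ≤ u ∧ u.StrictlyBelow b ∧ (∀ ξ ∈ S, ∃ s ≤ u, ht s = ξ ∧ h s = F ξ) ∧
      ∀ γ, ht t < γ → (∀ ξ ∈ S, ξ < γ) → ht u < γ by
    obtain ⟨u, hu, htu, hub, hcol, -⟩ := H
    exact ⟨u, hu, htu, hub, hcol⟩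
  induction S using Finset.induction_on_max with
  | empty => exact ⟨t, htK, le_rfl, htb, by simp, fun γ hγ _ => hγ⟩
  | insert ξ S hmax ih =>
    obtain ⟨u, hu, htu, hub, hcol, hht⟩ := ih fun η hη => hS η (Finset.mem_insert_of_mem hη)
    obtain ⟨htξ, hξδ⟩ := hS ξ (Finset.mem_insert_self _ _)
    obtain ⟨v, hv, huv, hvb, hvξ, hvF⟩ := hK u hu hub ξ hξδ (hht ξ htξ hmax)
    refine ⟨v, hv, htu.trans huv, hvb, fun η hη => ?_, fun γ _ hγ => ?_⟩
    · rcases Finset.mem_insert.1 hη with rfl | hη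
      · exact ⟨v, le_rfl, hvξ, hvF⟩
      · obtain ⟨s, hs, h⟩ := hcol η hη
        exact ⟨s, hs.trans huv, h⟩
    · rw [hvξ]
      exact hγ ξ (Finset.mem_insert_self _ _)

/-- The operations used against a colouring `g`: `op true` reaches any larger countable height
with any colour under `supColour e`; `op false` reaches the colour `m` under `g`, if that is
possible below `b` at all. -/
theorem exists_operations {e : ℚ → ℕ}
    (he : ∀ (a b : ℚ) (k : ℕ), a < b → ∃ q, a < q ∧ q < b ∧ e q = k)
    (C : LadderSystem) (f : C.Colouring) (g : SigmaQ → ℕ) :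
    ∃ op : Bool × ℚ × ℕ → Ordinal.{0} → SigmaQ → SigmaQ,
      ∀ t ∈ uniformizingSet C f (SigmaQ.supColour e), ∀ b, t.StrictlyBelow b → ∀ m ξ,
        (ht t < ξ → ξ < ω₁ → op (true, b, m) ξ t ∈ uniformizingSet C f (SigmaQ.supColour e) ∧
          t ≤ op (true, b, m) ξ t ∧ (op (true, b, m) ξ t).StrictlyBelow b ∧
          ht (op (true, b, m) ξ t) = ξ ∧ SigmaQ.supColour e (op (true, b, m) ξ t) = m) ∧
        (op (false, b, m) ξ t ∈ uniformizingSet C f (SigmaQ.supColour e) ∧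
          t ≤ op (false, b, m) ξ t ∧ (op (false, b, m) ξ t).StrictlyBelow b ∧
          (g (op (false, b, m) ξ t) = m ∨
            ∀ u ∈ uniformizingSet C f (SigmaQ.supColour e), t ≤ u → u.StrictlyBelow b →
              g u ≠ m)) := by
  have hgrow : ∀ (t : SigmaQ) (b : ℚ) (m : ℕ) (ξ : Ordinal.{0}), ∃ u,
      t ∈ uniformizingSet C f (SigmaQ.supColour e) → t.StrictlyBelow b → ht t < ξ → ξ < ω₁ →
        u ∈ uniformizingSet C f (SigmaQ.supColour e) ∧ t ≤ u ∧ u.StrictlyBelow b ∧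
          ht u = ξ ∧ SigmaQ.supColour e u = m := by
    intro t b m ξ
    by_cases hyp : t ∈ uniformizingSet C f (SigmaQ.supColour e) ∧ t.StrictlyBelow b ∧
      ht t < ξ ∧ ξ < ω₁
    · obtain ⟨ht_mem, ⟨a, ha, hab⟩, htξ, hξ⟩ := hyp
      obtain ⟨u, hu, htu, huξ, q, hq, -, hqb, hqm⟩ :=
        exists_extension he C f hξ t ht_mem a b m htξ ha hab
      exact ⟨u, fun _ _ _ _ => ⟨hu, htu, ⟨q, hq.1, hqb⟩, huξ, (SigmaQ.supColour_eq hq).trans hqm⟩⟩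
    · exact ⟨t, fun h1 h2 h3 h4 => absurd ⟨h1, h2, h3, h4⟩ hyp⟩
  have hdecide : ∀ (t : SigmaQ) (b : ℚ) (m : ℕ), ∃ u,
      t ∈ uniformizingSet C f (SigmaQ.supColour e) → t.StrictlyBelow b →
        u ∈ uniformizingSet C f (SigmaQ.supColour e) ∧ t ≤ u ∧ u.StrictlyBelow b ∧
          (g u = m ∨ ∀ u ∈ uniformizingSet C f (SigmaQ.supColour e), t ≤ u → u.StrictlyBelow b →
            g u ≠ m) := by
    intro t b m
    by_cases hyp : ∃ u ∈ uniformizingSet C f (SigmaQ.supColour e), t ≤ u ∧ u.StrictlyBelow b ∧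
      g u = m
    · obtain ⟨u, hu, htu, hub, hum⟩ := hyp
      exact ⟨u, fun _ _ => ⟨hu, htu, hub, Or.inl hum⟩⟩
    · exact ⟨t, fun h1 h2 => ⟨h1, le_rfl, h2,
        Or.inr fun u hu htu hub hum => hyp ⟨u, hu, htu, hub, hum⟩⟩⟩
  choose G hG using hgrow
  choose D hD using hdecide
  exact ⟨fun i ξ t => if i.1 then G t i.2.1 i.2.2 ξ else D t i.2.1 i.2.2,
    fun t ht_mem b hb m ξ => ⟨fun h1 h2 => hG t b m ξ ht_mem hb h1 h2, hD t b m ht_mem hb⟩⟩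

theorem not_isSpecial_uniformizingSet {e : ℚ → ℕ}
    (he : ∀ (a b : ℚ) (k : ℕ), a < b → ∃ q, a < q ∧ q < b ∧ e q = k)
    (C : LadderSystem) (f : C.Colouring) :
    ¬ IsSpecial (uniformizingSet C f (SigmaQ.supColour e)) := by
  classical
  set T := uniformizingSet C f (SigmaQ.supColour e) with hT
  rintro ⟨g₀, hg₀⟩
  let g : SigmaQ → ℕ := fun t => if h : t ∈ T then g₀ ⟨t, h⟩ else 0
  have hg : ∀ s ∈ T, ∀ t ∈ T, s < t → g s ≠ g t := by
    intro s hs t ht hst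
    simp only [g, dif_pos hs, dif_pos ht]
    exact hg₀ ⟨s, hs⟩ ⟨t, ht⟩ hst
  obtain ⟨op, hop⟩ := exists_operations he C f g
  -- A strictly increasing sequence of closure points `δ n`, with supremum `α`.
  obtain ⟨δ, hδ⟩ : ∃ δ : ℕ → Ordinal.{0}, ∀ n,
      (δ n < ω₁ ∧ ∀ t, Reachable op SigmaQ.root (δ n) t → ht t < δ n) ∧ δ n < δ (n + 1) := by
    refine exists_seq_of_step (P := fun _ x => x < ω₁ ∧
      ∀ t, Reachable op SigmaQ.root x t → ht t < x) (R := fun _ x y => x < y) ?_ ?_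
    · obtain ⟨δ, hδ, -, h⟩ := Reachable.exists_closed (op := op) (x₀ := SigmaQ.root)
        SigmaQ.ht_lt_omega_one (omega_pos 1)
      exact ⟨δ, hδ, h⟩
    · rintro - γ ⟨hγ, -⟩
      obtain ⟨δ, hδ, hγδ, h⟩ := Reachable.exists_closed (op := op) (x₀ := SigmaQ.root)
        SigmaQ.ht_lt_omega_one hγ
      exact ⟨δ, ⟨hδ, h⟩, hγδ⟩
  have hδsup : ∀ n, δ n < ⨆ n, δ n := fun n => (hδ n).2.trans_le (Ordinal.le_iSup δ (n + 1))
  have hδmono : StrictMono δ := strictMono_nat_of_lt_succ fun n => (hδ n).2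
  have hlim : Order.IsSuccLimit (⨆ n, δ n) := by
    refine ⟨fun hmin => not_lt_zero ((hδsup 0).trans_le (hmin bot_le)), ?_⟩
    refine Order.isSuccPrelimit_of_succ_lt fun γ hγ => ?_
    obtain ⟨n, hn⟩ := Ordinal.lt_iSup_iff.1 hγ
    exact (Order.succ_le_of_lt hn).trans_lt (hδsup n)
  let α : LimOmegaOne := ⟨⨆ n, δ n, iSup_lt_omega_one fun n => (hδ n).1.1, hlim⟩
  let F : Ordinal.{0} → ℕ := fun ξ => if h : ξ ∈ C.ladder α then f α ⟨ξ, h⟩ else 0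
  -- The pairs `(t, b)` of the fusion: `b` shrinks so that the limit stays strictly below each `b`.
  let P : ℕ → SigmaQ × ℚ → Prop := fun n p =>
    Reachable op SigmaQ.root (δ n) p.1 ∧ p.1 ∈ T ∧ p.1.StrictlyBelow p.2
  let R : ℕ → SigmaQ × ℚ → SigmaQ × ℚ → Prop := fun n p p' =>
    p.1 ≤ p'.1 ∧ p'.2 < p.2 ∧ δ n ≤ ht p'.1 ∧
      (∀ ξ ∈ C.ladder α, δ n ≤ ξ → ξ < δ (n + 1) →
        ∃ s ≤ p'.1, ht s = ξ ∧ SigmaQ.supColour e s = F ξ) ∧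
      (g p'.1 = n ∨ ∀ u ∈ T, p'.1 ≤ u → u.StrictlyBelow p.2 → g u ≠ n)
  have h0 : ∃ p, P 0 p :=
    ⟨(SigmaQ.root, 1), Reachable.base, root_mem_uniformizingSet C f _, 0, by simp [SigmaQ.root],
      one_pos⟩
  have hstep : ∀ n p, P n p → ∃ p', P (n + 1) p' ∧ R n p p' := by
    rintro n ⟨t, b⟩ ⟨htR, htT, htb⟩
    have hδpos : 0 < δ (n + 1) := bot_le.trans_lt (hδ n).2
    have hfin : {ξ ∈ C.ladder α | ξ < δ (n + 1)}.Finite := C.finite_lt α (hδsup _)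
    obtain ⟨u, ⟨huR, huT⟩, htu, hub, hcol⟩ := exists_extension_finset
      (h := SigmaQ.supColour e) (K := {t | Reachable op SigmaQ.root (δ (n + 1)) t} ∩ T) (b := b)
      (δ := δ (n + 1)) F
      (by
        rintro s ⟨hsR, hsT⟩ hsb ξ hξδ hsξ
        obtain ⟨h1, h2, h3, h4, h5⟩ := (hop s hsT b hsb (F ξ) ξ).1 hsξ (hξδ.trans (hδ _).1.1)
        exact ⟨_, ⟨Reachable.step _ hξδ hsR, h1⟩, h2, h3, h4, h5⟩)
      ⟨htR.mono (hδ n).2.le, htT⟩ htb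
      (insert (δ n) (hfin.toFinset.filter (δ n ≤ ·)))
      (by
        have htδ : ht t < δ n := (hδ n).1.2 t htR
        intro ξ hξ
        rcases Finset.mem_insert.1 hξ with rfl | hξ
        · exact ⟨htδ, (hδ n).2⟩
        · obtain ⟨hξ1, hξ2⟩ := Finset.mem_filter.1 hξ
          exact ⟨htδ.trans_le hξ2, ((hfin.mem_toFinset).1 hξ1).2⟩)
    obtain ⟨hvT, huv, hvb, hvg⟩ := (hop u huT b hub n 0).2
    set v := op (false, b, n) 0 u with hv
    obtain ⟨q, hq, hqb⟩ := hvb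
    obtain ⟨b', hqb', hbb'⟩ := exists_between hqb
    refine ⟨(v, b'), ⟨Reachable.step _ hδpos huR, hvT, q, hq, hqb'⟩, htu.trans huv, hbb', ?_, ?_, ?_⟩
    · obtain ⟨s, hs, hsδ, -⟩ := hcol (δ n) (Finset.mem_insert_self _ _)
      exact hsδ.symm.le.trans (ht_le_ht (hs.trans huv))
    · intro ξ hξ h1 h2
      obtain ⟨s, hs, h⟩ := hcol ξ (Finset.mem_insert_of_mem
        (Finset.mem_filter.2 ⟨hfin.mem_toFinset.2 ⟨hξ, h2⟩, h1⟩))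
      exact ⟨s, hs.trans huv, h⟩
    · exact hvg.imp_right fun h w hw hvw hwb => h w hw (huv.trans hvw) hwb
  obtain ⟨p, hp⟩ := exists_seq_of_step h0 hstep
  have htmono : Monotone fun n => (p n).1 := monotone_nat_of_le_succ fun n => (hp n).2.1
  have hbanti : Antitone fun n => (p n).2 := antitone_nat_of_succ_le fun n => (hp n).2.2.1.le
  have hub : ∀ n m, (p n).2 ∈ upperBounds (p m).1.carrier := by
    intro n m x hx
    obtain ⟨q, hq, hqb⟩ := (hp (max n m)).1.2.2
    exact (hq ((htmono (le_max_right n m)).1 hx)).trans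
      (hqb.le.trans (hbanti (le_max_left n m)))
  obtain ⟨u, hucar, hpu, hpred⟩ := SigmaQ.exists_iUnion htmono (hub 0)
  have hplt : ∀ n, ht (p n).1 < α.1 := fun n => ((hδ n).1.2 _ (hp n).1.1).trans (hδsup n)
  have huα : ht u = α.1 := by
    refine SigmaQ.ht_eq_of_iUnion hpu hpred hplt (fun β hβ => ?_) hlim
    obtain ⟨n, hn⟩ := Ordinal.lt_iSup_iff.1 hβ
    exact ⟨n + 1, hn.le.trans (hp n).2.2.2.1⟩
  have huT : u ∈ T := by
    refine mem_uniformizingSet_of_iUnion α huα hpred (fun n => (hp n).1.2.1) (hδsup 0)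
      fun ξ hξ => ?_
    -- Locate `ξ` in one of the intervals `[δ n, δ (n + 1))`.
    have hex : ∃ n, ξ.1 < δ n := Ordinal.lt_iSup_iff.1 (C.lt_of_mem α _ ξ.2)
    obtain ⟨n, hn1, hn2⟩ : ∃ n, δ n ≤ ξ.1 ∧ ξ.1 < δ (n + 1) := by
      obtain ⟨n, hn⟩ : ∃ n, Nat.find hex = n + 1 :=
        Nat.exists_eq_succ_of_ne_zero fun h0 => (h0 ▸ Nat.find_spec hex).not_ge hξ
      exact ⟨n, not_lt.1 (Nat.find_min hex (by omega)), hn ▸ Nat.find_spec hex⟩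
    obtain ⟨s, hs, hsξ, hsF⟩ := (hp n).2.2.2.2.1 ξ.1 ξ.2 hn1 hn2
    refine ⟨s, hs.trans (hpu _), hsξ, hsF.trans ?_⟩
    simp only [F, dif_pos ξ.2]
  -- Stage `g u` of the construction has excluded the colour of `u`.
  have hlt : (p (g u + 1)).1 < u :=
    (hpu _).lt_of_ne fun h => (hplt (g u + 1)).ne (by rw [h, huα])
  rcases (hp (g u)).2.2.2.2.2 with h | h
  · exact hg _ (hp _).1.2.1 u huT hlt h
  · refine h u huT (hpu _) ⟨(p (g u + 1)).2, fun x hx => ?_, (hp _).2.2.1⟩ rfl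
    rw [hucar] at hx
    obtain ⟨m, hm⟩ := mem_iUnion.1 hx
    exact hub _ m hm

theorem theorem5p2 :
    ∃ h : SigmaQ → ℕ, ∀ (C : LadderSystem) (f : C.Colouring),
      ∃ T : Set SigmaQ, UniformizesOn C f h T ∧ ¬ IsOrderTree.IsSpecial T := by
  obtain ⟨e, he⟩ := exists_dense_colouring
  exact ⟨SigmaQ.supColour e, fun C f => ⟨uniformizingSet C f (SigmaQ.supColour e),
    ⟨isSubtree_uniformizingSet he C f, fun s hs α hα => hs s le_rfl α hα⟩,
    not_isSpecial_uniformizingSet he C f⟩⟩
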